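/- Let $V$ be a vector space of finite dimension $r$ over a field $k$ of characteristic zero, and let $\Delta\subset V$ be a finite set of nonzero vectors which spans $V$. Let $R_\Delta=\Delta^{-1}S(V)$ be the localization of the symmetric algebra $S(V)$ obtained by inverting the elements of $\Delta$; it is graded by degree. A subset of $\Delta$ is called generating if it spans $V$, and a basis of $\Delta$ if it is a basis of $V$; let $\mathcal B(\Delta)$ be the set of bases of $\Delta$. Let $G_\Delta\subset R_\Delta$ be the $k$-linear span of the elements $1/\prod_{\alpha\in\kappa}\alpha^{n_\alpha}$, where $\kappa\subset\Delta$ is generating and the $n_\alpha$ are positive integers, and let $S_\Delta$ be the part of $G_\Delta$ of degree $-r$. For $\sigma\in\mathcal B(\Delta)$ put $\phi_\sigma=1/\prod_{\alpha\in\sigma}\alpha\in S_\Delta$. Fix a total ordering of $\Delta$, and let $B\subset\mathcal B(\Delta)$ be the set of those bases $b$ of $\Delta$ such that for every $\gamma\in\Delta\setminus b$ the set $\{\gamma\}\cup\{\beta\in b:\beta>\gamma\}$ is linearly independent. Then: 1. The family $(\phi_b)_{b\in B}$ is a basis of the $k$-vector space $S_\Delta$. 2. Let $L$ be the $k$-vector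 space with basis the symbols $[\sigma]$, $\sigma\in\mathcal B(\Delta)$. The space of linear relations between the $\phi_\sigma$, that is, the kernel of the linear map $L\to R_\Delta$, $[\sigma]\mapsto\phi_\sigma$, is the $k$-linear span of the Orlik–Solomon relations $$r_{\sigma,\alpha}=[\sigma]-\sum_{\beta\in\sigma,\ c_{\alpha\beta}\neq 0}c_{\alpha\beta}\,[\sigma\cup\{\alpha\}\setminus\{\beta\}],$$ where $\sigma\in\mathcal B(\Delta)$, $\alpha\in\Delta\setminus\sigma$ and $\alpha=\sum_{\beta\in\sigma}c_{\alpha\beta}\beta$. (The set $\sigma\cup\{\alpha\}\setminus\{\beta\}$ is a basis of $\Delta$ exactly when $c_{\alpha\beta}\neq0$.) -/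

import Mathlib

noncomputable section

namespace OrlikSolomon

variable {k : Type*} [Field k] {V : Type*} [AddCommGroup V] [Module k V]

/-- The ring `R_Δ = Δ⁻¹ S(V)`: the localization of the symmetric algebra of `V` (polynomial
functions on `V*`) at the multiplicative set generated by the elements of `Δ`. -/
abbrev R (k : Type*) [Field k] {V : Type*} [AddCommGroup V] [Module k V] (Δ : Finset V) : Type _ :=
  Localization (Submonoid.closure (SymmetricAlgebra.ι k V '' (Δ : Set V)))

/-- The element `1 / α` of `R_Δ`, for `α ∈ Δ`. -/
def inv (k : Type*) [Field k] {V : Type*} [AddCommGroup V] [Module k V] {Δ : Finset V}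
    (α : Δ) : R k Δ :=
  Localization.mk 1
    ⟨SymmetricAlgebra.ι k V α, Submonoid.subset_closure (Set.mem_image_of_mem _ α.2)⟩

/-- `φ_κ = 1 / ∏_{α ∈ κ} α`, for a subset `κ` of `Δ`. -/
def phi (k : Type*) [Field k] {V : Type*} [AddCommGroup V] [Module k V] {Δ : Finset V}
    (κ : Finset Δ) : R k Δ :=
  ∏ α ∈ κ, inv k α

/-- A subset `κ` of `Δ` is generating if its elements span `V`. -/
def IsGenerating (k : Type*) [Field k] {V : Type*} [AddCommGroup V] [Module k V] {Δ : Finset V}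
    (κ : Finset Δ) : Prop :=
  Submodule.span k ((fun α : Δ => (α : V)) '' (κ : Set Δ)) = ⊤

/-- A subset `κ` of `Δ` is a basis of `Δ` if its elements form a basis of `V`. -/
def IsBasis (k : Type*) [Field k] {V : Type*} [AddCommGroup V] [Module k V] {Δ : Finset V}
    (κ : Finset Δ) : Prop :=
  LinearIndepOn k (fun α : Δ => (α : V)) (κ : Set Δ) ∧ IsGenerating k κ

/-- The set `𝓑(Δ)` of all bases of `Δ`. -/
abbrev Bases (k : Type*) [Field k] {V : Type*} [AddCommGroup V] [Module k V]
    (Δ : Finset V) : Type _ :=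
  {σ : Finset Δ // IsBasis k σ}

/-- `G_Δ`: the span in `R_Δ` of all `1 / ∏_{α ∈ κ} α ^ n_α` with `κ ⊆ Δ` generating and all
`n_α` positive. -/
def G (k : Type*) [Field k] {V : Type*} [AddCommGroup V] [Module k V] (Δ : Finset V) :
    Submodule k (R k Δ) :=
  Submodule.span k
    {f | ∃ (κ : Finset Δ) (n : Δ → ℕ), IsGenerating k κ ∧ (∀ α ∈ κ, 0 < n α) ∧
      f = ∏ α ∈ κ, inv k α ^ n α}

/-- `R_Δ[d]`, the part of degree `d ∈ ℤ` of `R_Δ`: the span of all `p / ∏_{α ∈ Δ} α ^ m_α`, where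
`p ∈ S(V)` is homogeneous of degree `a`, that is, lies in the `a`-th power of the subspace
`V ⊆ S(V)`, and where `a - ∑_α m_α = d`. -/
def gradedPart (k : Type*) [Field k] {V : Type*} [AddCommGroup V] [Module k V] (Δ : Finset V)
    (d : ℤ) : Submodule k (R k Δ) :=
  Submodule.span k
    {f | ∃ (a : ℕ) (p : SymmetricAlgebra k V) (m : Δ → ℕ),
      p ∈ LinearMap.range (SymmetricAlgebra.ι k V) ^ a ∧ (a : ℤ) - ∑ α, (m α : ℤ) = d ∧
      f = algebraMap (SymmetricAlgebra k V) (R k Δ) p * ∏ α, inv k α ^ m α}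

/-- `S_Δ = G_Δ[-r]`, the part of degree `-r` of `G_Δ`, where `r = dim V`. -/
def S (k : Type*) [Field k] {V : Type*} [AddCommGroup V] [Module k V] (Δ : Finset V) :
    Submodule k (R k Δ) :=
  G k Δ ⊓ gradedPart k Δ (-(Module.finrank k V : ℤ))

/-- Membership in the set `B` attached to an ordering of `Δ`: the bases `b` of `Δ` such that for
each `γ ∈ Δ` that is not in `b`, the set `{γ} ∪ {β ∈ b | β > γ}` is linearly independent. -/
def IsNBC (k : Type*) [Field k] {V : Type*} [AddCommGroup V] [Module k V] {Δ : Finset V}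
    [LinearOrder Δ] (b : Finset Δ) : Prop :=
  IsBasis k b ∧ ∀ γ : Δ, γ ∉ b →
    LinearIndepOn k (fun α : Δ => (α : V)) (insert γ {β : Δ | β ∈ b ∧ γ < β})

open Classical in
/-- `σ ∪ {α} \ {β}` -/
def exchange {Δ : Finset V} (σ : Finset Δ) (α β : Δ) : Finset Δ :=
  insert α (σ.erase β)

/-- The natural map from the free vector space `L` on the symbols `[σ]`, `σ ∈ 𝓑(Δ)`, to `R_Δ`,
which sends `[σ]` to `φ_σ`. -/
def natMap (k : Type*) [Field k] {V : Type*} [AddCommGroup V] [Module k V] (Δ : Finset V) :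
    (Bases k Δ →₀ k) →ₗ[k] R k Δ :=
  Finsupp.linearCombination k fun σ : Bases k Δ => phi k σ.1

/-- The space of linear relations between the `φ_σ`, `σ ∈ 𝓑(Δ)`. -/
def relations (k : Type*) [Field k] {V : Type*} [AddCommGroup V] [Module k V] (Δ : Finset V) :
    Submodule k (Bases k Δ →₀ k) :=
  LinearMap.ker (natMap k Δ)

open Classical in
/-- The generator `[κ]` of `L` if `κ` is a basis of `Δ`, and `0` otherwise. -/
def symbol (k : Type*) [Field k] {V : Type*} [AddCommGroup V] [Module k V] {Δ : Finset V}
    (κ : Finset Δ) : Bases k Δ →₀ k :=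
  if h : IsBasis k κ then Finsupp.single ⟨κ, h⟩ 1 else 0

/-- The element `r_{σ,α} = [σ] - ∑_{β ∈ σ} c_β [σ ∪ {α} \ {β}]` of `L`, to be used for
`α = ∑_{β ∈ σ} c_β β`. In that case `σ ∪ {α} \ {β}` is a basis if and only if `c_β ≠ 0`
(`isBasis_exchange_iff` below), so that `symbol` takes its default value `0` only in terms whose
coefficient is `0` anyway. -/
def osRelation {Δ : Finset V} (σ : Finset Δ) (α : Δ) (c : Δ → k) : Bases k Δ →₀ k :=
  symbol k σ - ∑ β ∈ σ, c β • symbol k (exchange σ α β)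

/-- The span of the Orlik–Solomon relations `r_{σ,α}`, where `σ` is a basis of `Δ`,
`α ∈ Δ \ σ` and `α = ∑_{β ∈ σ} c_β β`. -/
def osRelations (k : Type*) [Field k] {V : Type*} [AddCommGroup V] [Module k V] (Δ : Finset V) :
    Submodule k (Bases k Δ →₀ k) :=
  Submodule.span k
    {x | ∃ (σ : Finset Δ) (α : Δ) (c : Δ → k), IsBasis k σ ∧ α ∉ σ ∧
      (α : V) = ∑ β ∈ σ, c β • (β : V) ∧ x = osRelation σ α c}

theorem isBasis_exchange_iff {Δ : Finset V} {σ : Finset Δ} (hσ : IsBasis k σ) {α : Δ}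
    (hα : α ∉ σ) {c : Δ → k} (hc : (α : V) = ∑ β ∈ σ, c β • (β : V)) {β : Δ} (hβ : β ∈ σ) :
    IsBasis k (exchange σ α β) ↔ c β ≠ 0 := by
  classical
  have hcoe : ((exchange σ α β : Finset Δ) : Set Δ) = insert α ((σ : Set Δ) \ {β}) := by
    ext x
    simp only [exchange, Finset.coe_insert, Set.mem_insert_iff, Finset.mem_coe, Set.mem_sdiff,
      Set.mem_singleton_iff, Finset.mem_erase]
    tauto
  have hsplit : (α : V) = c β • (β : V) + ∑ γ ∈ σ.erase β, c γ • (γ : V) := by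
    rw [hc, Finset.add_sum_erase σ (fun γ : Δ => c γ • (γ : V)) hβ]
  set W := Submodule.span k ((fun γ : Δ => (γ : V)) '' ((σ : Set Δ) \ {β})) with hW
  have hrest : ∑ γ ∈ σ.erase β, c γ • (γ : V) ∈ W := by
    refine Submodule.sum_mem _ fun γ hγ => Submodule.smul_mem _ _ (Submodule.subset_span ?_)
    rw [Finset.mem_erase] at hγ
    exact ⟨γ, ⟨hγ.2, hγ.1⟩, rfl⟩
  have hσβ : LinearIndepOn k (fun γ : Δ => (γ : V)) ((σ : Set Δ) \ {β}) :=
    hσ.1.mono Set.sdiff_subset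
  have hβW : (β : V) ∉ W := by
    have h := hσ.1
    rw [← Set.insert_sdiff_self_of_mem (Finset.mem_coe.2 hβ), linearIndepOn_insert (by simp)] at h
    exact h.2
  have hα' : α ∉ (σ : Set Δ) \ {β} := fun h => hα h.1
  unfold IsBasis IsGenerating
  rw [hcoe, linearIndepOn_insert hα']
  constructor
  · rintro ⟨⟨-, h⟩, -⟩ h0
    apply h
    have : (α : V) ∈ W := by rw [hsplit, h0, zero_smul, zero_add]; exact hrest
    exact this
  · intro h0
    refine ⟨⟨hσβ, fun h => hβW ?_⟩, ?_⟩
    · have h1 : c β • (β : V) ∈ W := by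
        rw [eq_sub_of_add_eq hsplit.symm]
        exact W.sub_mem h hrest
      exact (W.smul_mem_iff h0).1 h1
    · rw [eq_top_iff, ← hσ.2, Submodule.span_le]
      have hle : W ≤ Submodule.span k
          ((fun γ : Δ => (γ : V)) '' insert α ((σ : Set Δ) \ {β})) :=
        Submodule.span_mono (Set.image_mono (Set.subset_insert _ _))
      rintro _ ⟨γ, hγ, rfl⟩
      by_cases hγβ : γ = β
      · subst hγβ
        refine (Submodule.smul_mem_iff _ h0).1 ?_
        rw [eq_sub_of_add_eq hsplit.symm]
        exact Submodule.sub_mem _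
          (Submodule.subset_span ⟨α, Set.mem_insert _ _, rfl⟩) (hle hrest)
      · exact hle (Submodule.subset_span ⟨γ, ⟨hγ, hγβ⟩, rfl⟩)

end OrlikSolomon

end

noncomputable section

namespace OrlikSolomon

variable {k : Type*} [Field k] {V : Type*} [AddCommGroup V] [Module k V]

/-! Three facts combine. (i) The Orlik–Solomon relations hold in `R k Δ`, and they straighten every
symbol: L is the sum of their span and the span of the symbols of B. If a basis fails to be in B,
some γ outside it is a combination of larger elements of it, and the relation replaces each of these
in turn by the smaller γ; this terminates. (ii) The φ_b, b in B, are independent. Clearing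
denominators turns a relation into one between the products over the complements of the b in S(V).
Deletion–contraction of the largest vector δ then applies: modulo δ only the terms with δ in b
survive, and they give a relation for the contraction; once these vanish, δ cancels from the rest.
(iii) The φ_σ span `S k Δ`: a generating set has at least r elements, so degree -r forces a basis
with all exponents 1. Degrees are separated as eigenspaces of the automorphism induced by v ↦ 2v,
whose eigenvalues 2^d are distinct in characteristic zero. By (ii) the symbols of B meet the
relations only in 0, so by (i) every relation is Orlik–Solomon. -/

/-- The symmetric algebra of a vector space has no zero divisors. -/
instance symmetricAlgebra_noZeroDivisors : NoZeroDivisors (SymmetricAlgebra k V) :=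
  (SymmetricAlgebra.equivMvPolynomial (Module.Basis.ofVectorSpace k V)).injective.noZeroDivisors
    _ (map_zero _) (map_mul _)

theorem symmetricAlgebra_ι_ne_zero {w : V} (hw : w ≠ 0) : SymmetricAlgebra.ι k V w ≠ 0 := by
  intro h
  obtain ⟨g, hg⟩ : ∃ g : Module.Dual k V, g w ≠ 0 := by
    by_contra! hg
    exact hw ((Module.forall_dual_apply_eq_zero_iff k w).1 hg)
  apply hg
  rw [← SymmetricAlgebra.lift_ι_apply (f := g) w, h, map_zero]

/-- The projection to a complement of the line stands in for the quotient by w, so that contraction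
stays inside V. -/
theorem exists_ker_eq_span_singleton (w : V) :
    ∃ f : V →ₗ[k] V, LinearMap.ker f = Submodule.span k {w} := by
  obtain ⟨q, hq⟩ := (Submodule.span k {w}).exists_isCompl
  refine ⟨q.subtype ∘ₗ q.projectionOnto _ hq.symm, ?_⟩
  rw [LinearMap.ker_comp_of_ker_eq_bot _ q.ker_subtype, Submodule.ker_projectionOnto]

theorem linearIndepOn_comp_of_insert {ι : Type*} {v : ι → V} {a : ι} {t : Set ι} (ha : a ∉ t)
    {f : V →ₗ[k] V} (hf : LinearMap.ker f = Submodule.span k {v a})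
    (h : LinearIndepOn k v (insert a t)) : LinearIndepOn k (f ∘ v) t := by
  rw [linearIndepOn_insert ha] at h
  have h0 : v a ≠ 0 := fun h0 => h.2 (h0 ▸ Submodule.zero_mem _)
  refine LinearIndependent.map (v := fun x : t => v x) h.1 ?_
  rw [hf, Submodule.disjoint_span_singleton' h0, ← Set.image_eq_range]
  exact h.2

/-! ### Deletion–contraction for sets without broken circuits -/

/-- A subset `b` of `s` without broken circuits, for a family `v` of vectors. -/
def IsNBCIn (k : Type*) [Field k] {V : Type*} [AddCommGroup V] [Module k V] {ι : Type*}
    [LinearOrder ι] (v : ι → V) (s b : Finset ι) : Prop :=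
  LinearIndepOn k v (b : Set ι) ∧
    ∀ γ ∈ s, γ ∉ b → LinearIndepOn k v (insert γ {β : ι | β ∈ b ∧ γ < β})

theorem IsNBCIn.mono {ι : Type*} [LinearOrder ι] {v : ι → V} {s t b : Finset ι} (hst : s ⊆ t)
    (h : IsNBCIn k v t b) : IsNBCIn k v s b :=
  ⟨h.1, fun γ hγ => h.2 γ (hst hγ)⟩

/-- As δ exceeds every γ in `s`, it belongs to each set required to be independent, and the other
members stay independent modulo `v δ`. -/
theorem IsNBCIn.comp_of_insert {ι : Type*} [LinearOrder ι] {v : ι → V} {s b : Finset ι} {δ : ι}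
    (hδ : ∀ x ∈ s, x < δ) (hb : b ⊆ s) {f : V →ₗ[k] V}
    (hf : LinearMap.ker f = Submodule.span k {v δ})
    (h : IsNBCIn k v (insert δ s) (insert δ b)) : IsNBCIn k (f ∘ v) s b := by
  have hδb : δ ∉ b := fun hm => lt_irrefl _ (hδ _ (hb hm))
  constructor
  · refine linearIndepOn_comp_of_insert (a := δ) (by simpa using hδb) hf ?_
    rw [← Finset.coe_insert]
    exact h.1
  · intro γ hγ hγb
    have hne : γ ≠ δ := (hδ γ hγ).ne
    refine linearIndepOn_comp_of_insert (a := δ) ?_ hf ?_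
    · simp [hne.symm, hδb]
    · refine (h.2 γ (Finset.mem_insert_of_mem hγ) (by simp [hne, hγb])).mono ?_
      intro x
      simp only [Set.mem_insert_iff, Set.mem_ofPred_eq, Finset.mem_insert]
      rintro (rfl | rfl | ⟨hx, hx'⟩)
      · exact Or.inr ⟨Or.inl rfl, hδ _ hγ⟩
      · exact Or.inl rfl
      · exact Or.inr ⟨Or.inr hx, hx'⟩

/-- The complementary products `∏_{i ∈ s \ b} v_i`, where `b` runs over the subsets of `s` without
broken circuits, are linearly independent in the symmetric algebra. -/
theorem eq_zero_of_sum_smul_prod_sdiff_eq_zero {ι : Type*} [LinearOrder ι] (s : Finset ι) :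
    ∀ (v : ι → V) (a : Finset ι → k), (∀ b ⊆ s, a b ≠ 0 → IsNBCIn k v s b) →
      ∑ b ∈ s.powerset, a b • ∏ i ∈ s \ b, SymmetricAlgebra.ι k V (v i) = 0 →
      ∀ b ⊆ s, a b = 0 := by
  induction s using Finset.induction_on_max with
  | empty =>
    intro v a _ h b hb
    rw [Finset.subset_empty.1 hb]
    simpa using h
  | insert δ s hδ ih =>
    intro v a ha h
    have hδs : δ ∉ s := fun hm => lt_irrefl _ (hδ _ hm)
    -- The complement of b contains δ exactly when b does not, so only those terms carry the factor
    -- `v δ`.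
    have hsplit : SymmetricAlgebra.ι k V (v δ) *
          ∑ b ∈ s.powerset, a b • ∏ i ∈ s \ b, SymmetricAlgebra.ι k V (v i) +
        ∑ b ∈ s.powerset, a (insert δ b) • ∏ i ∈ s \ b, SymmetricAlgebra.ι k V (v i) = 0 := by
      rw [← h, Finset.sum_powerset_insert hδs, Finset.mul_sum]
      congr 1 <;> refine Finset.sum_congr rfl fun b hb => ?_
      · have hδb : δ ∉ b := fun hm => hδs (Finset.mem_powerset.1 hb hm)
        rw [Finset.insert_sdiff_of_notMem _ hδb, Finset.prod_insert (by simp [hδs]),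
          mul_smul_comm]
      · rw [Finset.insert_sdiff_insert, Finset.sdiff_insert_of_notMem hδs]
    obtain ⟨f, hf⟩ := exists_ker_eq_span_singleton (k := k) (v δ)
    have hfδ : f (v δ) = 0 := by
      rw [← LinearMap.mem_ker, hf]
      exact Submodule.mem_span_singleton_self _
    have h1 : ∀ b ⊆ s, a (insert δ b) = 0 := by
      refine ih (f ∘ v) (fun b => a (insert δ b)) (fun b hb hab => ?_) ?_
      · exact (ha _ (Finset.insert_subset_insert _ hb) hab).comp_of_insert hδ hb hf
      · have := congrArg (SymmetricAlgebra.lift (SymmetricAlgebra.ι k V ∘ₗ f)) hsplit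
        simpa [hfδ, map_sum, map_prod] using this
    have h2 : ∀ b ⊆ s, a b = 0 := by
      -- Contraction can create zero vectors. If `v δ = 0`, no set without broken circuits omits δ;
      -- otherwise `v δ` cancels.
      by_cases h0 : v δ = 0
      · intro b hb
        by_contra hab
        have hδb : δ ∉ b := fun hm => hδs (hb hm)
        have := (ha b (hb.trans (Finset.subset_insert _ _)) hab).2 δ (Finset.mem_insert_self _ _) hδb
        exact this.ne_zero (Set.mem_insert _ _) h0
      · refine ih v a (fun b hb hab => ?_) ?_
        · exact (ha b (hb.trans (Finset.subset_insert _ _)) hab).mono (Finset.subset_insert _ _)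
        · rw [Finset.sum_eq_zero (s := s.powerset) (f := fun b => a (insert δ b) • _) fun b hb => by
            rw [h1 b (Finset.mem_powerset.1 hb), zero_smul], add_zero] at hsplit
          exact (mul_eq_zero.1 hsplit).resolve_left (symmetricAlgebra_ι_ne_zero h0)
    intro b hb
    by_cases hδb : δ ∈ b
    · rw [← Finset.insert_erase hδb]
      exact h1 _ (Finset.subset_insert_iff.1 hb)
    · exact h2 b ((Finset.subset_insert_iff_of_notMem hδb).1 hb)

/-! ### The Orlik–Solomon relations and clearing of denominators -/

variable {Δ : Finset V}

theorem algebraMap_smul_eq (c : k) (p : SymmetricAlgebra k V) :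
    algebraMap (SymmetricAlgebra k V) (R k Δ) (c • p) = c • algebraMap _ _ p :=
  (IsScalarTower.toAlgHom k (SymmetricAlgebra k V) (R k Δ)).toLinearMap.map_smul c p

theorem algebraMap_ι_mul_inv (α : Δ) :
    algebraMap (SymmetricAlgebra k V) (R k Δ) (SymmetricAlgebra.ι k V α) * inv k α = 1 := by
  rw [inv, Localization.mk_eq_mk']
  exact (IsLocalization.mk'_spec' (R k Δ) 1 _).trans (map_one _)

theorem algebraMap_ι_mul_phi [DecidableEq Δ] {σ : Finset Δ} {β : Δ} (hβ : β ∈ σ) :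
    algebraMap (SymmetricAlgebra k V) (R k Δ) (SymmetricAlgebra.ι k V β) * phi k σ =
      phi k (σ.erase β) := by
  rw [phi, phi, ← Finset.mul_prod_erase σ _ hβ, ← mul_assoc, algebraMap_ι_mul_inv, one_mul]

theorem exchange_eq_insert_erase {V : Type*} {Δ : Finset V} [DecidableEq Δ] (σ : Finset Δ)
    (α β : Δ) : exchange σ α β = insert α (σ.erase β) := by
  rw [exchange]
  congr!

theorem phi_exchange [DecidableEq Δ] {σ : Finset Δ} {α β : Δ} (hα : α ∉ σ) :
    phi k (exchange σ α β) = inv k α * phi k (σ.erase β) := by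
  rw [phi, exchange_eq_insert_erase, Finset.prod_insert fun h => hα (Finset.mem_of_mem_erase h), phi]

/-- Multiply by α/α and expand the numerator; each β cancels its own factor of the denominator. -/
theorem phi_eq_sum_exchange {σ : Finset Δ} {α : Δ} (hα : α ∉ σ) {c : Δ → k}
    (hc : (α : V) = ∑ β ∈ σ, c β • (β : V)) :
    phi k σ = ∑ β ∈ σ, c β • phi k (exchange σ α β) := by
  classical
  calc phi k σ = inv k α * (algebraMap (SymmetricAlgebra k V) (R k Δ)
        (SymmetricAlgebra.ι k V α) * phi k σ) := by
        rw [← mul_assoc, mul_comm (inv k α), algebraMap_ι_mul_inv, one_mul]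
    _ = inv k α * ∑ β ∈ σ, c β • phi k (σ.erase β) := by
        rw [hc, map_sum, map_sum, Finset.sum_mul]
        congr 1
        refine Finset.sum_congr rfl fun β hβ => ?_
        rw [map_smul, algebraMap_smul_eq, smul_mul_assoc, algebraMap_ι_mul_phi hβ]
    _ = _ := by
        rw [Finset.mul_sum]
        refine Finset.sum_congr rfl fun β _ => ?_
        rw [phi_exchange hα, mul_smul_comm]

theorem natMap_symbol {σ : Finset Δ} (hσ : IsBasis k σ) :
    natMap k Δ (symbol k σ) = phi k σ := by
  rw [symbol, dif_pos hσ, natMap, Finsupp.linearCombination_single, one_smul]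

theorem osRelations_le_relations : osRelations k Δ ≤ relations k Δ := by
  rw [osRelations, Submodule.span_le]
  rintro _ ⟨σ, α, c, hσ, hα, hc, rfl⟩
  rw [SetLike.mem_coe, relations, LinearMap.mem_ker, osRelation, map_sub, natMap_symbol hσ,
    phi_eq_sum_exchange hα hc, map_sum, sub_eq_zero]
  refine Finset.sum_congr rfl fun β hβ => ?_
  by_cases h0 : c β = 0
  · simp [h0]
  · rw [map_smul, natMap_symbol ((isBasis_exchange_iff hσ hα hc hβ).2 h0)]

theorem algebraMap_injective (hΔ : ∀ α ∈ Δ, α ≠ 0) :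
    Function.Injective (algebraMap (SymmetricAlgebra k V) (R k Δ)) := by
  refine IsLocalization.injective (M := Submonoid.closure (SymmetricAlgebra.ι k V '' (Δ : Set V)))
    (R k Δ) (Submonoid.closure_le.2 ?_)
  rintro _ ⟨α, hα, rfl⟩
  exact mem_nonZeroDivisors_of_ne_zero (symmetricAlgebra_ι_ne_zero (hΔ α hα))

theorem algebraMap_prod_univ_mul_phi [DecidableEq Δ] (b : Finset Δ) :
    algebraMap (SymmetricAlgebra k V) (R k Δ) (∏ α : Δ, SymmetricAlgebra.ι k V α) * phi k b =
      algebraMap _ _ (∏ α ∈ Finset.univ \ b, SymmetricAlgebra.ι k V (α : V)) := by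
  rw [← Finset.prod_sdiff (Finset.subset_univ b), map_mul, mul_assoc, map_prod _ _ b, phi,
    ← Finset.prod_mul_distrib, Finset.prod_eq_one fun α _ => algebraMap_ι_mul_inv α, mul_one]

/-! ### Straightening, and independence of the φ_b -/

section NBC

variable [LinearOrder Δ]

theorem exists_eq_sum_of_not_isNBC {σ : Finset Δ} (hσ : IsBasis k σ) (h : ¬ IsNBC k σ) :
    ∃ γ ∉ σ, ∃ c : Δ → k, (γ : V) = ∑ β ∈ σ, c β • (β : V) ∧ ∀ β, c β ≠ 0 → γ < β := by
  simp only [IsNBC, hσ, true_and, not_forall] at h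
  obtain ⟨γ, hγ, h⟩ := h
  refine ⟨γ, hγ, ?_⟩
  rw [linearIndepOn_insert (by simp [hγ])] at h
  have hγ' := not_not.1 (not_and.1 h (hσ.1.mono fun β hβ => hβ.1))
  rw [Finsupp.mem_span_image_iff_linearCombination] at hγ'
  obtain ⟨l, hl, hlγ⟩ := hγ'
  rw [Finsupp.mem_supported] at hl
  refine ⟨l, ?_, fun β hβ => (hl (Finsupp.mem_support_iff.2 hβ)).2⟩
  rw [← hlγ, Finsupp.linearCombination_apply]
  exact Finsupp.sum_of_support_subset _ (fun β hβ => (hl hβ).1) _ (by simp)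

/-- The sum of the positions of the elements of `σ` in the ordering of `ι`. -/
def weight {ι : Type*} [Fintype ι] [LinearOrder ι] (σ : Finset ι) : ℕ :=
  ∑ β ∈ σ, (Finset.univ.filter (· < β)).card

theorem weight_insert_erase_lt {ι : Type*} [Fintype ι] [LinearOrder ι] {σ : Finset ι} {α β : ι}
    (hα : α ∉ σ) (hβ : β ∈ σ) (h : α < β) : weight (insert α (σ.erase β)) < weight σ := by
  rw [weight, weight, Finset.sum_insert fun h => hα (Finset.mem_of_mem_erase h),
    ← Finset.add_sum_erase σ _ hβ]
  refine Nat.add_lt_add_right (Finset.card_lt_card ?_) _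
  rw [Finset.ssubset_iff_of_subset fun x hx => by
    simp only [Finset.mem_filter_univ] at hx ⊢; exact hx.trans h]
  exact ⟨α, by simpa using h, by simp⟩

/-- The span of the symbols of the bases without broken circuits. -/
def nbcSymbols (k : Type*) [Field k] {V : Type*} [AddCommGroup V] [Module k V] (Δ : Finset V)
    [LinearOrder Δ] : Submodule k (Bases k Δ →₀ k) :=
  Submodule.span k (Set.range fun b : {b : Finset Δ // IsNBC k b} => symbol k b.1)

theorem symbol_mem_osRelations_sup_nbcSymbols (σ : Finset Δ) (hσ : IsBasis k σ) :
    symbol k σ ∈ osRelations k Δ ⊔ nbcSymbols k Δ := by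
  induction hn : weight σ using Nat.strong_induction_on generalizing σ with
  | _ n ih =>
    by_cases h : IsNBC k σ
    · exact Submodule.mem_sup_right (Submodule.subset_span ⟨⟨σ, h⟩, rfl⟩)
    · obtain ⟨γ, hγ, c, hc, hlt⟩ := exists_eq_sum_of_not_isNBC hσ h
      rw [← sub_add_cancel (symbol k σ) (∑ β ∈ σ, c β • symbol k (exchange σ γ β))]
      refine add_mem (Submodule.mem_sup_left (Submodule.subset_span ⟨σ, γ, c, hσ, hγ, hc, rfl⟩))
        (Submodule.sum_mem _ fun β hβ => ?_)
      by_cases h0 : c β = 0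
      · rw [h0, zero_smul]
        exact Submodule.zero_mem _
      · refine Submodule.smul_mem _ _ (ih _ ?_ _ ?_ rfl)
        · rw [exchange_eq_insert_erase, ← hn]
          exact weight_insert_erase_lt hγ hβ (hlt β h0)
        · exact (isBasis_exchange_iff hσ hγ hc hβ).2 h0

theorem osRelations_sup_nbcSymbols : osRelations k Δ ⊔ nbcSymbols k Δ = ⊤ := by
  rw [eq_top_iff]
  intro x _
  induction x using Finsupp.induction_linear with
  | zero => exact zero_mem _
  | add x y hx hy => exact add_mem (hx trivial) (hy trivial)
  | single σ a =>
    have := Submodule.smul_mem _ a (symbol_mem_osRelations_sup_nbcSymbols σ.1 σ.2)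
    rwa [symbol, dif_pos σ.2, Finsupp.smul_single, smul_eq_mul, mul_one] at this

theorem linearIndependent_phi (hΔ : ∀ α ∈ Δ, α ≠ 0) :
    LinearIndependent k (fun b : {b : Finset Δ // IsNBC k b} => phi k b.1) := by
  have : DecidablePred (IsNBC k (Δ := Δ)) := Classical.decPred _
  rw [Fintype.linearIndependent_iff]
  intro g hg b
  -- Extension by zero to all subsets, as the induction over the power set requires.
  let a : Finset Δ → k := fun b => if h : IsNBC k b then g ⟨b, h⟩ else 0
  have key := eq_zero_of_sum_smul_prod_sdiff_eq_zero (k := k) Finset.univ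
    (fun α : Δ => (α : V)) a ?_ ?_ b.1 (Finset.subset_univ _)
  · simpa [a, b.2] using key
  · intro b _ hb
    have h : IsNBC k b := by
      by_contra h
      exact hb (dif_neg h)
    exact ⟨h.1.1, fun γ _ => h.2 γ⟩
  · apply algebraMap_injective hΔ
    calc algebraMap (SymmetricAlgebra k V) (R k Δ)
          (∑ b ∈ Finset.univ.powerset, a b • ∏ i ∈ Finset.univ \ b, SymmetricAlgebra.ι k V (i : V))
        = algebraMap _ _ (∏ α : Δ, SymmetricAlgebra.ι k V (α : V)) *
            ∑ b : Finset Δ, a b • phi k b := by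
          rw [map_sum, Finset.powerset_univ, Finset.mul_sum]
          refine Finset.sum_congr rfl fun b _ => ?_
          rw [algebraMap_smul_eq, ← algebraMap_prod_univ_mul_phi, mul_smul_comm]
      _ = algebraMap _ _ (∏ α : Δ, SymmetricAlgebra.ι k V (α : V)) *
            ∑ b : {b : Finset Δ // IsNBC k b}, a b.1 • phi k b.1 := by
          rw [← Finset.sum_subtype (Finset.univ.filter (IsNBC k)) (by simp)
            (fun b => a b • phi k b), Finset.sum_filter_of_ne]
          intro b _ hb
          by_contra h
          exact hb (by rw [show a b = 0 from dif_neg h, zero_smul])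
      _ = algebraMap (SymmetricAlgebra k V) (R k Δ) 0 := by
          rw [map_zero, ← mul_zero (algebraMap _ _ (∏ α : Δ, SymmetricAlgebra.ι k V (α : V))), ← hg]
          refine congrArg _ (Finset.sum_congr rfl fun b _ => ?_)
          rw [show a b.1 = g b from dif_pos b.2]

end NBC

/-! ### Separating degrees by scaling V by 2 -/

section Scale

variable [CharZero k]

theorem isUnit_lift_two_smul_ι (y : Submonoid.closure (SymmetricAlgebra.ι k V '' (Δ : Set V))) :
    IsUnit (SymmetricAlgebra.lift ((2 : k) • ((IsScalarTower.toAlgHom k (SymmetricAlgebra k V)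
      (R k Δ)).toLinearMap ∘ₗ SymmetricAlgebra.ι k V)) (y : SymmetricAlgebra k V)) := by
  obtain ⟨y, hy⟩ := y
  induction hy using Submonoid.closure_induction with
  | mem x hx =>
    obtain ⟨α, hα, rfl⟩ := hx
    simp only [SymmetricAlgebra.lift_ι_apply, LinearMap.smul_apply, LinearMap.comp_apply]
    refine IsUnit.of_mul_eq_one ((2 : k)⁻¹ • inv k (Δ := Δ) ⟨α, hα⟩) ?_
    rw [smul_mul_smul_comm, mul_inv_cancel₀ two_ne_zero, one_smul]
    exact algebraMap_ι_mul_inv ⟨α, hα⟩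
  | one => simp
  | mul x y _ _ hx hy =>
    rw [map_mul]
    exact hx.mul hy

/-- The endomorphism of `R_Δ` induced by multiplication by `2` on `V`. -/
def scale (k : Type*) [Field k] [CharZero k] {V : Type*} [AddCommGroup V] [Module k V]
    (Δ : Finset V) : R k Δ →ₐ[k] R k Δ :=
  IsLocalization.liftAlgHom (M := Submonoid.closure (SymmetricAlgebra.ι k V '' (Δ : Set V)))
    (f := SymmetricAlgebra.lift ((2 : k) • ((IsScalarTower.toAlgHom k (SymmetricAlgebra k V)
      (R k Δ)).toLinearMap ∘ₗ SymmetricAlgebra.ι k V))) isUnit_lift_two_smul_ι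

theorem scale_algebraMap_ι (x : V) :
    scale k Δ (algebraMap (SymmetricAlgebra k V) (R k Δ) (SymmetricAlgebra.ι k V x)) =
      (2 : k) • algebraMap (SymmetricAlgebra k V) (R k Δ) (SymmetricAlgebra.ι k V x) := by
  rw [scale, IsLocalization.liftAlgHom_apply, IsLocalization.lift_eq]
  exact SymmetricAlgebra.lift_ι_apply (R := k) _ x

theorem scale_inv (α : Δ) : scale k Δ (inv k α) = (2 : k)⁻¹ • inv k α := by
  have h := congrArg (scale k Δ) (algebraMap_ι_mul_inv (k := k) α)
  rw [map_mul, map_one, scale_algebraMap_ι, smul_mul_assoc] at h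
  calc scale k Δ (inv k α) =
        (algebraMap (SymmetricAlgebra k V) (R k Δ) (SymmetricAlgebra.ι k V (α : V)) * inv k α) *
        scale k Δ (inv k α) := by rw [algebraMap_ι_mul_inv, one_mul]
    _ = (2 : k)⁻¹ • (inv k α * ((2 : k) • (algebraMap (SymmetricAlgebra k V) (R k Δ) (SymmetricAlgebra.ι k V (α : V)) *
        scale k Δ (inv k α)))) := by
      rw [mul_smul_comm, smul_smul, inv_mul_cancel₀ two_ne_zero, one_smul]; ring
    _ = _ := by rw [h, mul_one]

theorem scale_prod_inv_pow (κ : Finset Δ) (n : Δ → ℕ) :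
    scale k Δ (∏ α ∈ κ, inv k α ^ n α) =
      (2 : k) ^ (-∑ α ∈ κ, (n α : ℤ)) • ∏ α ∈ κ, inv k α ^ n α := by
  rw [map_prod, ← Nat.cast_sum, zpow_neg, zpow_natCast, ← inv_pow, ← Finset.prod_pow_eq_pow_sum,
    ← Finset.prod_smul]
  refine Finset.prod_congr rfl fun α _ => ?_
  rw [map_pow, scale_inv, smul_pow]

theorem scale_algebraMap_of_mem_pow {a : ℕ} {p : SymmetricAlgebra k V}
    (hp : p ∈ LinearMap.range (SymmetricAlgebra.ι k V) ^ a) :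
    scale k Δ (algebraMap (SymmetricAlgebra k V) (R k Δ) p) = (2 : k) ^ a • algebraMap (SymmetricAlgebra k V) (R k Δ) p := by
  induction hp using Submodule.pow_induction_on_left' with
  | algebraMap r =>
    rw [← IsScalarTower.algebraMap_apply k (SymmetricAlgebra k V) (R k Δ), AlgHom.commutes, pow_zero, one_smul]
  | add x y i _ _ hx hy => rw [map_add, map_add, hx, hy, smul_add]
  | mem_mul m hm i x _ hx =>
    obtain ⟨v, rfl⟩ := hm
    rw [map_mul, map_mul, hx, scale_algebraMap_ι, smul_mul_smul_comm, pow_succ']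

theorem gradedPart_le_eigenspace (d : ℤ) :
    gradedPart k Δ d ≤ Module.End.eigenspace (scale k Δ).toLinearMap ((2 : k) ^ d) := by
  rw [gradedPart, Submodule.span_le]
  rintro _ ⟨a, p, m, hp, rfl, rfl⟩
  rw [SetLike.mem_coe, Module.End.mem_eigenspace_iff, AlgHom.toLinearMap_apply, map_mul,
    scale_algebraMap_of_mem_pow hp, scale_prod_inv_pow, smul_mul_smul_comm, sub_eq_add_neg,
    zpow_add₀ two_ne_zero, zpow_natCast]

theorem prod_inv_pow_mem_eigenspace (κ : Finset Δ) (n : Δ → ℕ) :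
    ∏ α ∈ κ, inv k α ^ n α ∈ Module.End.eigenspace (scale k Δ).toLinearMap
      ((2 : k) ^ (-∑ α ∈ κ, (n α : ℤ))) :=
  Module.End.mem_eigenspace_iff.2 (scale_prod_inv_pow κ n)

theorem two_zpow_injective : Function.Injective fun d : ℤ => (2 : k) ^ d := by
  intro m n h
  have h' : ((2 : ℚ) ^ m : ℚ) = 2 ^ n := by
    apply Rat.cast_injective (α := k)
    push_cast
    exact h
  exact zpow_right_injective₀ two_pos (by norm_num) h'

theorem iSupIndep_eigenspace_scale :
    iSupIndep fun d : ℤ => Module.End.eigenspace (scale k Δ).toLinearMap ((2 : k) ^ d) :=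
  (Module.End.eigenspaces_iSupIndep _).comp two_zpow_injective

end Scale

/-! ### The degree -r part is spanned by the φ_σ -/

theorem IsBasis.card_eq {σ : Finset Δ} (hσ : IsBasis k σ) : σ.card = Module.finrank k V := by
  have h := finrank_span_eq_card hσ.1
  rw [← Set.image_eq_range (fun α : Δ => (α : V)), hσ.2, finrank_top] at h
  simpa using h.symm

theorem IsGenerating.finrank_le_card {κ : Finset Δ} (hκ : IsGenerating k κ) :
    Module.finrank k V ≤ κ.card := by
  have h := finrank_range_le_card (R := k) (fun α : (κ : Set Δ) => (α : V))
  rw [Set.finrank, ← Set.image_eq_range (fun α : Δ => (α : V)), hκ, finrank_top] at h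
  simpa using h

theorem IsGenerating.isBasis_of_card_eq {κ : Finset Δ} (hκ : IsGenerating k κ)
    (h : κ.card = Module.finrank k V) : IsBasis k κ := by
  refine ⟨linearIndependent_of_top_le_span_of_card_eq_finrank ?_ (by simpa using h), hκ⟩
  rw [← Set.image_eq_range (fun α : Δ => (α : V)), hκ]

theorem phi_mem_S {σ : Finset Δ} (hσ : IsBasis k σ) : phi k σ ∈ S k Δ := by
  classical
  refine ⟨Submodule.subset_span ⟨σ, fun _ => 1, hσ.2, fun _ _ => one_pos, ?_⟩,
    Submodule.subset_span ⟨0, 1, fun α => if α ∈ σ then 1 else 0, ?_, ?_, ?_⟩⟩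
  · simp [phi]
  · rw [pow_zero]
    exact Submodule.one_le.1 le_rfl
  · rw [← hσ.card_eq]
    simp [-Finset.univ_eq_attach]
  · rw [map_one, one_mul, phi]
    simp [-Finset.univ_eq_attach, pow_ite]

theorem S_eq_span_phi [CharZero k] :
    S k Δ = Submodule.span k (Set.range fun σ : Bases k Δ => phi k σ.1) := by
  apply le_antisymm
  · set M := Submodule.span k (Set.range fun σ : Bases k Δ => phi k σ.1)
    set E : ℤ → Submodule k (R k Δ) :=
      fun d => Module.End.eigenspace (scale k Δ).toLinearMap ((2 : k) ^ d)
    set e : ℤ := -(Module.finrank k V : ℤ)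
    have hM : M ≤ E e := by
      rw [Submodule.span_le]
      rintro _ ⟨σ, rfl⟩
      exact gradedPart_le_eigenspace _ (phi_mem_S σ.2).2
    -- Generators of degree -r are some φ_σ; all others lie in eigenspaces of other degrees.
    have hG : G k Δ ≤ M ⊔ ⨆ d, ⨆ (_ : d ≠ e), E d := by
      rw [G, Submodule.span_le]
      rintro _ ⟨κ, n, hκ, hn, rfl⟩
      by_cases hd : -∑ α ∈ κ, (n α : ℤ) = e
      · refine Submodule.mem_sup_left (Submodule.subset_span ?_)
        have hsum : ∑ α ∈ κ, n α = Module.finrank k V := by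
          have := neg_injective hd
          exact_mod_cast this
        have hcard : κ.card = Module.finrank k V := by
          refine le_antisymm ?_ hκ.finrank_le_card
          rw [← hsum, Finset.card_eq_sum_ones]
          exact Finset.sum_le_sum hn
        -- There are r exponents, each at least 1, with sum r, so all equal 1.
        have h1 := (Finset.sum_eq_sum_iff_of_le (f := fun _ => 1) hn).1
          (by rw [← Finset.card_eq_sum_ones, hcard, ← hsum])
        refine ⟨⟨κ, hκ.isBasis_of_card_eq hcard⟩, Finset.prod_congr rfl fun α hα => ?_⟩
        rw [← h1 α hα, pow_one]
      · exact Submodule.mem_sup_right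
          (Submodule.mem_iSup_of_mem _ (Submodule.mem_iSup_of_mem hd
            (prod_inv_pow_mem_eigenspace κ n)))
    rintro x ⟨hxG, hxe⟩
    obtain ⟨m, hm, y, hy, rfl⟩ := Submodule.mem_sup.1 (hG hxG)
    -- The remainder y has degree -r and is also a sum of terms of other degrees, hence is zero.
    have hyE : y ∈ E e := by
      have := (E e).sub_mem (gradedPart_le_eigenspace _ hxe) (hM hm)
      rwa [add_sub_cancel_left] at this
    have hy0 : y = 0 :=
      Submodule.disjoint_def.1 (iSupIndep_eigenspace_scale (k := k) (Δ := Δ) e) y hyE hy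
    rwa [hy0, add_zero]
  · rw [Submodule.span_le]
    rintro _ ⟨σ, rfl⟩
    exact phi_mem_S σ.2

/-! ### Conclusion: spanning by B and the space of relations -/

section NBC

variable [LinearOrder Δ]

theorem map_nbcSymbols : (nbcSymbols k Δ).map (natMap k Δ) =
    Submodule.span k (Set.range fun b : {b : Finset Δ // IsNBC k b} => phi k b.1) := by
  rw [nbcSymbols, Submodule.map_span, ← Set.range_comp]
  congr 2
  funext b
  exact natMap_symbol b.2.1

theorem span_phi_nbc : Submodule.span k
    (Set.range fun b : {b : Finset Δ // IsNBC k b} => phi k b.1) =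
      Submodule.span k (Set.range fun σ : Bases k Δ => phi k σ.1) := by
  have h := congrArg (Submodule.map (natMap k Δ)) (osRelations_sup_nbcSymbols (k := k) (Δ := Δ))
  rwa [Submodule.map_sup, LinearMap.le_ker_iff_map.1 (osRelations_le_relations (k := k) (Δ := Δ)), bot_sup_eq,
    map_nbcSymbols, Submodule.map_top, natMap, Finsupp.range_linearCombination] at h

theorem disjoint_nbcSymbols_relations (hΔ : ∀ α ∈ Δ, α ≠ 0) :
    Disjoint (nbcSymbols k Δ) (relations k Δ) := by
  rw [Submodule.disjoint_def]
  intro x hx hx0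
  obtain ⟨l, rfl⟩ := Finsupp.mem_span_range_iff_exists_finsupp.1 hx
  have hl : l = 0 := by
    refine linearIndependent_iff.1 (linearIndependent_phi (k := k) hΔ) l ?_
    rw [relations, LinearMap.mem_ker, Finsupp.sum, map_sum] at hx0
    rw [Finsupp.linearCombination_apply, ← hx0]
    refine Finset.sum_congr rfl fun b _ => ?_
    rw [map_smul, natMap_symbol b.2.1]
  rw [hl, Finsupp.sum_zero_index]

/-- Modulo Orlik–Solomon relations, a relation becomes a combination of symbols of B that is still a
relation, hence zero. -/
theorem relations_eq_osRelations (hΔ : ∀ α ∈ Δ, α ≠ 0) : relations k Δ = osRelations k Δ := by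
  refine le_antisymm (fun x hx => ?_) osRelations_le_relations
  obtain ⟨y, hy, z, hz, rfl⟩ := Submodule.mem_sup.1
    (osRelations_sup_nbcSymbols (k := k) (Δ := Δ) ▸ Submodule.mem_top : x ∈ _)
  have hz0 : z = 0 := by
    refine Submodule.disjoint_def.1 (disjoint_nbcSymbols_relations hΔ) z hz ?_
    have := (relations k Δ).sub_mem hx (osRelations_le_relations hy)
    rwa [add_sub_cancel_left] at this
  rwa [hz0, add_zero]

end NBC

end OrlikSolomon

end

theorem mainTheorem4 {k : Type*} [Field k] [CharZero k] {V : Type*} [AddCommGroup V] [Module k V]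
    [FiniteDimensional k V] (Δ : Finset V) (hΔ : ∀ α ∈ Δ, α ≠ 0)
    (hspan : Submodule.span k (Δ : Set V) = ⊤) [LinearOrder Δ] :
    (LinearIndependent k
        (fun b : {b : Finset Δ // OrlikSolomon.IsNBC k b} => OrlikSolomon.phi k b.1) ∧
      Submodule.span k
        (Set.range fun b : {b : Finset Δ // OrlikSolomon.IsNBC k b} => OrlikSolomon.phi k b.1) =
          OrlikSolomon.S k Δ) ∧
    OrlikSolomon.relations k Δ = OrlikSolomon.osRelations k Δ :=
  ⟨⟨OrlikSolomon.linearIndependent_phi hΔ,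
    OrlikSolomon.span_phi_nbc.trans OrlikSolomon.S_eq_span_phi.symm⟩,
    OrlikSolomon.relations_eq_osRelations hΔ⟩
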